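/- Let $n \ge 1$ be an integer. A monochromatic component of an edge-coloring of a complete graph is a connected component of the spanning subgraph formed by all edges of one color (a vertex isolated in a color forms a one-vertex component of that color). Let $M(n,r)$ denote the largest integer $m$ such that every coloring of the edges of $K_n$ with $r$ colors has a monochromatic component with at least $m$ edges. Gyárfás's construction (for four colors) is the 4-coloring of the edges of $K_9$ whose vertices are the points of the affine plane $\mathbb{F}_3^2$, in which an edge is colored by which of $x$, $y$, $x+y$, $x-y$ is constant on the line through its two ends; thus each color class is a union of three vertex-disjoint triangles. A 4-coloring of $K_n$ is said to match Gyárfás's construction if there are a permutation of the colors and a bijection from its monochromatic components to those of Gyárfás's construction that respects colors up to this permutation and such that any family of components has a common vertex if and only if the corresponding family has a common vertex. Theorem. In every 4-coloring of the edges of $K_n$ there is a monochromatic component with at least $\frac{1}{12}\binom{n}{2}$ edges; that is, $$M(n,4) \ge \left\lceil \tfrac{1}{12}\tbinom{n}{2} \right\rceil .$$ Moreover, every 4-coloring of the edges of $K_n$ that does not match Gyárfás's construction has a monochromatic component with at least $\left(\frac{1}{12}+\varepsilon\right)\binom{n}{2}$ edges, where $$\varepsilon = \frac{2}{14+\sqrt{96}}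 - \frac{1}{12} > 0.0007 .$$ -/

import Mathlib

namespace ColoredComponents

open SimpleGraph

/-- A monochromatic connected component of an edge-coloring `c` of the complete graph on `V`:
a color `k` together with a connected component of the spanning graph formed by the edges of
color `k` (a vertex that is isolated in color `k` forms a one-vertex component). -/
abbrev MonoComponent {V K : Type*} (c : TopEdgeLabeling V K) : Type _ :=
  Σ k : K, (c.labelGraph k).ConnectedComponent

namespace MonoComponent

variable {V K : Type*} {c : TopEdgeLabeling V K}

/-- The color of a monochromatic component. -/
def color (C : MonoComponent c) : K := C.1

/-- The vertex set of a monochromatic component. -/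
def verts (C : MonoComponent c) : Set V := C.2.supp

/-- The number of edges of a monochromatic component. -/
noncomputable def numEdges (C : MonoComponent c) : ℕ := C.2.toSimpleGraph.edgeSet.ncard

end MonoComponent

/-- The set of all `m` such that every `r`-edge-coloring of `K_n` has a monochromatic component
with at least `m` edges. -/
def guaranteed (n r : ℕ) : Set ℕ :=
  {m | ∀ c : TopEdgeLabeling (Fin n) (Fin r), ∃ C : MonoComponent c, m ≤ C.numEdges}

/-- `M n r` is the largest `m` such that every `r`-edge-coloring of `K_n` has a monochromatic
component with at least `m` edges. -/
noncomputable def M (n r : ℕ) : ℕ := sSup (guaranteed n r)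

/-- For `n, r ≥ 1` the maximum in the definition of `M n r` exists. -/
theorem isGreatest_M (n r : ℕ) (hn : 1 ≤ n) (hr : 1 ≤ r) : IsGreatest (guaranteed n r) (M n r) := by
  have : NeZero r := ⟨by omega⟩
  have hne : (guaranteed n r).Nonempty :=
    ⟨0, fun c => ⟨⟨0, SimpleGraph.connectedComponentMk _ ⟨0, hn⟩⟩, Nat.zero_le _⟩⟩
  have hbd : BddAbove (guaranteed n r) := by
    let c : TopEdgeLabeling (Fin n) (Fin r) := fun _ => 0
    have : Finite (MonoComponent c) :=
      inferInstanceAs (Finite (Σ k : Fin r, (c.labelGraph k).ConnectedComponent))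
    obtain ⟨B, hB⟩ := (Set.finite_range (fun C : MonoComponent c => C.numEdges)).bddAbove
    refine ⟨B, fun m hm => ?_⟩
    obtain ⟨C, hC⟩ := hm c
    exact hC.trans (hB ⟨C, rfl⟩)
  exact ⟨Nat.sSup_mem hne hbd, fun m hm => le_csSup hbd hm⟩

/-- Two edge-colorings of (possibly different) complete graphs have the same component structure:
up to a permutation of the colors, there is a bijection between their monochromatic components
under which the intersection patterns of the vertex sets agree, that is, a family of components
of the first coloring has a common vertex if and only if the corresponding family of components
of the second one has a common vertex. -/
def SameComponentStructure {V W K : Type*} (c : TopEdgeLabeling V K)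
    (d : TopEdgeLabeling W K) : Prop :=
  ∃ (σ : Equiv.Perm K) (f : MonoComponent c ≃ MonoComponent d),
    (∀ C, (f C).color = σ C.color) ∧
    ∀ S : Set (MonoComponent c),
      (⋂ C ∈ S, C.verts).Nonempty ↔ (⋂ C ∈ S, (f C).verts).Nonempty

/-- The direction of the line through two distinct points of the affine plane of order 3:
`x` constant, `y` constant, `x + y` constant, or (otherwise) `x - y` constant. -/
def direction (p q : ZMod 3 × ZMod 3) : Fin 4 :=
  if p.1 = q.1 then 0 else if p.2 = q.2 then 1 else if p.1 + p.2 = q.1 + q.2 then 2 else 3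

/-- Gyárfás's construction for four colors: the vertices of `K_9` are the points of the affine
plane of order 3, and an edge is colored by the parallel class of the line through its ends. -/
def gyarfas : TopEdgeLabeling (ZMod 3 × ZMod 3) (Fin 4) :=
  EdgeLabeling.mk (fun p q _ => direction p q) (by
    have h : ∀ p q : ZMod 3 × ZMod 3, direction q p = direction p q := by decide
    intro p q _
    exact h p q)

/-- In Gyárfás's construction, two distinct points are joined in color `k` if and only if they
lie on a common line of the `k`-th parallel class. -/
theorem gyarfas_adj (k : Fin 4) (p q : ZMod 3 × ZMod 3) :
    (gyarfas.labelGraph k).Adj p q ↔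
      p ≠ q ∧ ![p.1, p.2, p.1 + p.2, p.1 - p.2] k = ![q.1, q.2, q.1 + q.2, q.1 - q.2] k := by
  have h : ∀ (k : Fin 4) (p q : ZMod 3 × ZMod 3), p ≠ q → (direction p q = k ↔
      ![p.1, p.2, p.1 + p.2, p.1 - p.2] k = ![q.1, q.2, q.1 + q.2, q.1 - q.2] k) := by decide
  rw [EdgeLabeling.labelGraph_adj]
  constructor
  · rintro ⟨hpq, e⟩
    exact ⟨hpq, (h k p q hpq).1 e⟩
  · rintro ⟨hpq, e⟩
    exact ⟨hpq, (h k p q hpq).2 e⟩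

end ColoredComponents

/-
Read a vertex as a word of four letters, the `k`-th letter being the component of color `k` that
contains it; any two of these words have a common letter. Suppose that every word has at least `t`
of its letters in a set `S` of components. The orders of the components outside `S` then add up to
at most `(4 - t) * n`. If no component had as many as `n.choose 2 / ρ ^ 2` edges, those in `S` would
contain fewer than `#S / ρ ^ 2` of all edges and those outside `S` at most `(4 - t) / ρ` of them,
because a component of order `m` has at most `m * (n - 1) / (2 * ρ)` edges. So such a component
exists once `#S + (4 - t) * ρ ≤ ρ ^ 2`. For `ρ = 1 + √6` this holds if `#S < 3 * t` and `2 ≤ t`,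
and if `#S = t = 1`.

Suppose that there is no such small cover. Then any two distinct words share exactly one letter, so
the degrees of the letters of a word add up to the number of words plus three. Every letter has
degree two or three, and since the letters of degree three, as well as all letters together, do not
form a small cover, double counting leaves nine words that form an orthogonal array of strength 2 on
three levels. This is the affine plane of order 3, and its twelve lines form a cover with `t = 4`,
to which the bound applies with `ρ = √12`.
-/

namespace ColoredComponents

open Finset SimpleGraph

section Words

variable {ι : Type*} {α : ι → Type*}

/-- Any two words of `H` have a common letter at some position. -/
def IsIntersecting (H : Set (∀ i, α i)) : Prop := ∀ u ∈ H, ∀ w ∈ H, ∃ i, u i = w i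

/-- `S` is a `t`-fold cover of `H`: every word of `H` has at least `t` of its letters in `S`, where
a letter is recorded together with its position. -/
def IsCover (t : ℕ) (S : Finset (Σ i, α i)) (H : Set (∀ i, α i)) : Prop :=
  ∀ w ∈ H, ∃ I : Finset ι, t ≤ #I ∧ ∀ i ∈ I, ⟨i, w i⟩ ∈ S

/-- `H` has a `t`-fold cover with fewer than `3 * t` letters (a single letter if `t = 1`). These are
the covers that force a component with more than `1 / 12` of the edges. -/
def HasSmallCover (H : Set (∀ i, α i)) : Prop :=
  ∃ t S, IsCover t S H ∧ (t = 1 ∧ #S = 1 ∨ 2 ≤ t ∧ #S < 3 * t)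

theorem hasSmallCover_of_forall_eq {H : Set (∀ i, α i)} {i : ι} {a : α i}
    (h : ∀ w ∈ H, w i = a) : HasSmallCover H :=
  ⟨1, {⟨i, a⟩}, fun w hw => ⟨{i}, by simp [h w hw]⟩, .inl ⟨rfl, card_singleton _⟩⟩

theorem hasSmallCover_of_double {H : Set (∀ i, α i)} {S : Finset (Σ i, α i)} (hS : #S ≤ 5)
    (h : ∀ w ∈ H, ∃ i j, i ≠ j ∧ ⟨i, w i⟩ ∈ S ∧ ⟨j, w j⟩ ∈ S) : HasSmallCover H := by
  classical
  refine ⟨2, S, fun w hw => ?_, .inr ⟨le_rfl, by omega⟩⟩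
  obtain ⟨i, j, hij, hi, hj⟩ := h w hw
  exact ⟨{i, j}, (card_pair hij).ge, by simp [hi, hj]⟩

theorem sum_card_filter_apply_eq {β : Type*} [Fintype ι]
    [DecidableEq (Σ i, α i)] [∀ i, DecidableEq (α i)] (T : Finset (Σ i, α i)) (s : Finset β)
    (f : β → ∀ i, α i) :
    ∑ x ∈ T, #{b ∈ s | f b x.1 = x.2} = ∑ b ∈ s, #{i | ⟨i, f b i⟩ ∈ T} := by
  calc ∑ x ∈ T, #{b ∈ s | f b x.1 = x.2}
      = ∑ b ∈ s, #{x ∈ T | f b x.1 = x.2} := by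
        simp only [card_filter]
        exact sum_comm
    _ = ∑ b ∈ s, #{i | ⟨i, f b i⟩ ∈ T} := by
        refine sum_congr rfl fun b _ => (card_bij (fun i _ => ⟨i, f b i⟩) ?_ ?_ ?_).symm
        · exact fun i hi => mem_filter.2 ⟨(mem_filter.1 hi).2, rfl⟩
        · exact fun i _ j _ hij => congrArg Sigma.fst hij
        · rintro ⟨i, a⟩ hx
          obtain ⟨hx, hi : f b i = a⟩ := mem_filter.1 hx
          exact ⟨i, mem_filter.2 ⟨mem_univ i, hi ▸ hx⟩, hi ▸ rfl⟩

end Words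

section FourColors

variable {α : Fin 4 → Type*} {H : Set (∀ i, α i)} {i j k l : Fin 4}

theorem exists_nodup_four : ∀ {i j k : Fin 4}, i ≠ j → i ≠ k → j ≠ k → ∃ l, [i, j, k, l].Nodup := by
  decide

theorem eq_or_of_nodup_four :
    ∀ {i j k l : Fin 4}, [i, j, k, l].Nodup → ∀ m, m = i ∨ m = j ∨ m = k ∨ m = l := by
  decide

theorem IsIntersecting.eq_or (hH : IsIntersecting H) (hd : [i, j, k, l].Nodup) {u w : ∀ i, α i}
    (hu : u ∈ H) (hw : w ∈ H) : u i = w i ∨ u j = w j ∨ u k = w k ∨ u l = w l := by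
  obtain ⟨m, hm⟩ := hH u hu w hw
  rcases eq_or_of_nodup_four hd m with rfl | rfl | rfl | rfl <;> tauto

theorem hasSmallCover_of_pair (hH : IsIntersecting H) (hij : i ≠ j) {a : α i} {b : α j}
    (h : ∀ w ∈ H, w i = a ∨ w j = b) : HasSmallCover H := by
  classical
  by_cases ha : ∀ w ∈ H, w i = a
  · exact hasSmallCover_of_forall_eq ha
  by_cases hb : ∀ w ∈ H, w j = b
  · exact hasSmallCover_of_forall_eq hb
  push Not at ha hb
  obtain ⟨p, hp, hpi⟩ := ha
  obtain ⟨q, hq, hqj⟩ := hb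
  have hpj : p j = b := (h p hp).resolve_left hpi
  have hqi : q i = a := (h q hq).resolve_right hqj
  obtain ⟨k, hk⟩ := hH p hp q hq
  have hik : i ≠ k := by rintro rfl; exact hpi (hk.trans hqi)
  have hjk : j ≠ k := by rintro rfl; exact hqj (hk.symm.trans hpj)
  obtain ⟨l, hd⟩ := exists_nodup_four hij hik hjk
  refine hasSmallCover_of_double
    (S := {⟨i, a⟩, ⟨j, b⟩, ⟨k, p k⟩, ⟨l, p l⟩, ⟨l, q l⟩}) card_le_five fun w hw => ?_
  have hwp := hH.eq_or hd hw hp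
  have hwq := hH.eq_or hd hw hq
  have hwij := h w hw
  have : w i = a ∧ w j = b ∨ w i = a ∧ w k = p k ∨ w i = a ∧ w l = p l ∨
      w j = b ∧ w k = p k ∨ w j = b ∧ w l = q l := by
    clear hd
    grind
  simp only [List.nodup_cons, List.mem_cons, List.not_mem_nil, or_false, not_or] at hd
  rcases this with ⟨h₁, h₂⟩ | ⟨h₁, h₂⟩ | ⟨h₁, h₂⟩ | ⟨h₁, h₂⟩ | ⟨h₁, h₂⟩
  · exact ⟨i, j, by tauto, by simp [h₁], by simp [h₂]⟩
  · exact ⟨i, k, by tauto, by simp [h₁], by simp [h₂]⟩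
  · exact ⟨i, l, by tauto, by simp [h₁], by simp [h₂]⟩
  · exact ⟨j, k, by tauto, by simp [h₁], by simp [h₂]⟩
  · exact ⟨j, l, by tauto, by simp [h₁], by simp [h₂]⟩

theorem exists_of_not_hasSmallCover (hs : ¬ HasSmallCover H) {S : Finset (Σ i, α i)}
    (hS : #S ≤ 5) :
    ∃ w ∈ H, ∀ x ∈ S, ∀ y ∈ S, x.1 ≠ y.1 → w x.1 = x.2 → w y.1 ≠ y.2 := by
  contrapose! hs
  refine hasSmallCover_of_double hS fun w hw => ?_
  obtain ⟨x, hx, y, hy, hxy, hwx, hwy⟩ := hs w hw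
  exact ⟨x.1, y.1, hxy, by rwa [hwx], by rwa [hwy]⟩

/-- When the letters of `e` outside position `l` cover `H`, the words of `H` which only the letter
of `e` at `m` covers. -/
def privateWords (H : Set (∀ i, α i)) (e : ∀ i, α i) (l m : Fin 4) : Set (∀ i, α i) :=
  {w ∈ H | ∀ n ≠ l, w n = e n ↔ n = m}

theorem exists_distinct_representatives {β : Type*} {A B C : Set β}
    (hA : A.Nonempty) (hB : B.Nonempty) (hC : C.Nonempty) (hAB : ∀ t, ∃ x ∈ A ∪ B, x ≠ t)
    (hAC : ∀ t, ∃ x ∈ A ∪ C, x ≠ t) (hBC : ∀ t, ∃ x ∈ B ∪ C, x ≠ t)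
    (hABC : ∀ s t, ∃ x ∈ A ∪ B ∪ C, x ≠ s ∧ x ≠ t) :
    ∃ a ∈ A, ∃ b ∈ B, ∃ c ∈ C, a ≠ b ∧ a ≠ c ∧ b ≠ c := by
  obtain ⟨a, ha⟩ := hA
  obtain ⟨b, hb⟩ := hB
  obtain ⟨c, hc⟩ := hC
  obtain ⟨a, ha, b, hb, hab⟩ : ∃ a ∈ A, ∃ b ∈ B, a ≠ b := by
    obtain ⟨x, hx, hxt⟩ := hAB a
    grind
  obtain ⟨x, hx, hxa, hxb⟩ := hABC a b
  obtain ⟨y, hy, hya⟩ := hAC a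
  obtain ⟨z, hz, hzb⟩ := hBC b
  grind

section Triple

variable {e : ∀ i, α i}

theorem mem_privateWords (hd : [i, j, k, l].Nodup) {w : ∀ i, α i} :
    w ∈ privateWords H e l i ↔ w ∈ H ∧ w i = e i ∧ w j ≠ e j ∧ w k ≠ e k := by
  have := eq_or_of_nodup_four hd
  constructor
  · rintro ⟨hw, h⟩
    exact ⟨hw, by grind⟩
  · rintro ⟨hw, h⟩
    exact ⟨hw, by grind⟩

theorem exists_ne_and_iff (hd : [i, j, k, l].Nodup) {P : Fin 4 → Prop} :
    (∃ m ≠ l, P m) ↔ P i ∨ P j ∨ P k := by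
  constructor
  · rintro ⟨m, hml, hm⟩
    rcases eq_or_of_nodup_four hd m with rfl | rfl | rfl | rfl <;> tauto
  · rintro (h | h | h)
    · exact ⟨i, by grind, h⟩
    · exact ⟨j, by grind, h⟩
    · exact ⟨k, by grind, h⟩

theorem privateWords_nonempty (hs : ¬ HasSmallCover H) (hH : IsIntersecting H)
    (h : ∀ w ∈ H, ∃ m ≠ l, w m = e m) (hd : [i, j, k, l].Nodup) :
    (privateWords H e l i).Nonempty := by
  by_contra hempty
  refine hs (hasSmallCover_of_pair (a := e j) (b := e k) hH (by grind) fun w hw => ?_)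
  have := (exists_ne_and_iff hd).1 (h w hw)
  have := mt (fun h => ⟨w, (mem_privateWords hd).2 h⟩) hempty
  tauto

theorem exists_privateWords_ne_ne (hs : ¬ HasSmallCover H)
    (h : ∀ w ∈ H, ∃ m ≠ l, w m = e m) (hd : [i, j, k, l].Nodup) (s t : α l) :
    ∃ w ∈ privateWords H e l i ∪ privateWords H e l j ∪ privateWords H e l k,
      w l ≠ s ∧ w l ≠ t := by
  classical
  obtain ⟨w, hw, hwS⟩ := exists_of_not_hasSmallCover hs
    (S := {⟨i, e i⟩, ⟨j, e j⟩, ⟨k, e k⟩, ⟨l, s⟩, ⟨l, t⟩}) card_le_five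
  simp only [mem_insert, mem_singleton, forall_eq_or_imp, forall_eq] at hwS
  have := (exists_ne_and_iff hd).1 (h w hw)
  simp only [Set.mem_union, mem_privateWords hd,
    mem_privateWords (show [j, i, k, l].Nodup by grind),
    mem_privateWords (show [k, i, j, l].Nodup by grind)]
  exact ⟨w, by grind, by grind⟩

theorem exists_privateWords_ne (hs : ¬ HasSmallCover H) (hH : IsIntersecting H)
    (h : ∀ w ∈ H, ∃ m ≠ l, w m = e m) (hd : [i, j, k, l].Nodup) (t : α l) :
    ∃ w ∈ privateWords H e l i ∪ privateWords H e l j, w l ≠ t := by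
  classical
  have hd' : [j, i, k, l].Nodup := by grind
  by_contra! hall
  obtain ⟨q, hq⟩ := privateWords_nonempty hs hH h hd'
  have hql := hall q (.inr hq)
  obtain ⟨w, hw, hwS⟩ := exists_of_not_hasSmallCover hs
    (S := {⟨i, e i⟩, ⟨j, e j⟩, ⟨k, e k⟩, ⟨l, t⟩, ⟨i, q i⟩}) card_le_five
  simp only [mem_insert, mem_singleton, forall_eq_or_imp, forall_eq] at hwS
  have := (exists_ne_and_iff hd).1 (h w hw)
  have := hH.eq_or hd hw hq.1
  have := hall w
  simp only [Set.mem_union, mem_privateWords hd, mem_privateWords hd'] at this hq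
  clear h hall
  grind

theorem eq_of_mem_privateWords (hH : IsIntersecting H) (hd : [i, j, k, l].Nodup)
    {p q : ∀ i, α i} (hp : p ∈ privateWords H e l i) (hq : q ∈ privateWords H e l j)
    (hpq : p l ≠ q l) : p k = q k := by
  have := hH.eq_or hd hp.1 hq.1
  rw [mem_privateWords hd] at hp
  rw [mem_privateWords (show [j, i, k, l].Nodup by grind)] at hq
  grind

theorem exists_mem_of_privateWords_ne (hs : ¬ HasSmallCover H) (hH : IsIntersecting H)
    (h : ∀ w ∈ H, ∃ m ≠ l, w m = e m) (hd : [i, j, k, l].Nodup)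
    {p q r : ∀ i, α i} (hp : p ∈ privateWords H e l i) (hq : q ∈ privateWords H e l j)
    (hr : r ∈ privateWords H e l k) (hpq : p l ≠ q l) (hpr : p l ≠ r l) (hqr : q l ≠ r l) :
    ∃ w ∈ H, w l = r l ∧ w k = p k ∧
      (w i = e i ∧ w j ≠ e j ∧ w j ≠ r j ∨ w j = e j ∧ w i ≠ e i ∧ w i ≠ r i) := by
  classical
  have hpqk := eq_of_mem_privateWords hH hd hp hq hpq
  have hprj := eq_of_mem_privateWords hH (show [i, k, j, l].Nodup by grind) hp hr hpr
  have hqri := eq_of_mem_privateWords hH (show [j, k, i, l].Nodup by grind) hq hr hqr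
  obtain ⟨w, hw, hwS⟩ := exists_of_not_hasSmallCover hs
    (S := {⟨i, e i⟩, ⟨j, e j⟩, ⟨k, e k⟩, ⟨i, r i⟩, ⟨j, r j⟩}) card_le_five
  simp only [mem_insert, mem_singleton, forall_eq_or_imp, forall_eq] at hwS
  have := (exists_ne_and_iff hd).1 (h w hw)
  have := hH.eq_or hd hw hp.1
  have := hH.eq_or hd hw hq.1
  have := hH.eq_or hd hw hr.1
  rw [mem_privateWords hd] at hp
  rw [mem_privateWords (show [j, i, k, l].Nodup by grind)] at hq
  rw [mem_privateWords (show [k, i, j, l].Nodup by grind)] at hr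
  exact ⟨w, hw, by grind⟩

theorem hasSmallCover_of_triple (hH : IsIntersecting H) (h : ∀ w ∈ H, ∃ m ≠ l, w m = e m) :
    HasSmallCover H := by
  by_contra hs
  obtain ⟨i, j, k, hd⟩ :=
    (show ∀ l : Fin 4, ∃ i j k, [i, j, k, l].Nodup by decide) l
  have hd₁ : [i, k, j, l].Nodup := by grind
  have hd₂ : [j, k, i, l].Nodup := by grind
  have hd₃ : [k, i, j, l].Nodup := by grind
  obtain ⟨_, ⟨p, hp, rfl⟩, _, ⟨q, hq, rfl⟩, _, ⟨r, hr, rfl⟩, hpq, hpr, hqr⟩ :=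
    exists_distinct_representatives
      ((privateWords_nonempty hs hH h hd).image (· l))
      ((privateWords_nonempty hs hH h hd₂).image (· l))
      ((privateWords_nonempty hs hH h hd₃).image (· l))
      (fun t => by simpa [← Set.image_union] using exists_privateWords_ne hs hH h hd t)
      (fun t => by simpa [← Set.image_union] using exists_privateWords_ne hs hH h hd₁ t)
      (fun t => by simpa [← Set.image_union] using exists_privateWords_ne hs hH h hd₂ t)
      (fun s t => by simpa [← Set.image_union] using exists_privateWords_ne_ne hs h hd s t)
  dsimp only at hpq hpr hqr
  have := eq_of_mem_privateWords hH hd hp hq hpq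
  have := eq_of_mem_privateWords hH hd₁ hp hr hpr
  have := eq_of_mem_privateWords hH hd₂ hq hr hqr
  obtain ⟨x, hx, hx'⟩ := exists_mem_of_privateWords_ne hs hH h hd hp hq hr hpq hpr hqr
  obtain ⟨y, hy, hy'⟩ := exists_mem_of_privateWords_ne hs hH h hd₁ hp hr hq hpr hpq hqr.symm
  obtain ⟨z, hz, hz'⟩ := exists_mem_of_privateWords_ne hs hH h hd₂ hq hr hp hqr hpq.symm hpr.symm
  have := hH.eq_or hd hx hy
  have := hH.eq_or hd hx hz
  have := hH.eq_or hd hy hz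
  rw [mem_privateWords hd] at hp
  rw [mem_privateWords hd₂] at hq
  rw [mem_privateWords hd₃] at hr
  clear hd hd₁ hd₂ hd₃ h
  grind

theorem exists_mem_forall_ne (hs : ¬ HasSmallCover H) (hH : IsIntersecting H) (e : ∀ i, α i)
    (l : Fin 4) : ∃ w ∈ H, ∀ m ≠ l, w m ≠ e m := by
  contrapose! hs
  exact hasSmallCover_of_triple hH hs

theorem eq_of_forall_ne_eq (hs : ¬ HasSmallCover H) (hH : IsIntersecting H) {u v : ∀ i, α i}
    (hu : u ∈ H) (hv : v ∈ H) (h : ∀ m ≠ l, u m = v m) : u = v := by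
  obtain ⟨w, hw, hwu⟩ := exists_mem_forall_ne hs hH u l
  obtain ⟨m, hm⟩ := hH w hw u hu
  obtain ⟨n, hn⟩ := hH w hw v hv
  grind

end Triple

end FourColors

section AgreeTwice

variable {α : Fin 4 → Type*} {H : Set (∀ i, α i)} {i j k l : Fin 4}

/-- `u` and `v` are words of `H` which agree exactly at the first two of the four positions
`i, j, k, l`. -/
structure AgreeTwice (H : Set (∀ i, α i)) (u v : ∀ i, α i) (i j k l : Fin 4) : Prop where
  nodup : [i, j, k, l].Nodup
  mem_left : u ∈ H
  mem_right : v ∈ H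
  eq_fst : u i = v i
  eq_snd : u j = v j
  ne_fst : u k ≠ v k
  ne_snd : u l ≠ v l

/-- The words of `H` which share with `u` exactly the letter at `k` among those at `i, j, k`, and
have the letter of `v` at `l`. -/
def crossingWords (H : Set (∀ i, α i)) (u v : ∀ i, α i) (i j k l : Fin 4) : Set (∀ i, α i) :=
  {w ∈ H | w i ≠ u i ∧ w j ≠ u j ∧ w k = u k ∧ w l = v l}

namespace AgreeTwice

variable {u v p p' q q' w : ∀ i, α i}

theorem swap_left (h : AgreeTwice H u v i j k l) : AgreeTwice H u v j i k l :=
  ⟨by grind [h.nodup], h.2, h.3, h.5, h.4, h.6, h.7⟩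

theorem swap_right (h : AgreeTwice H u v i j k l) : AgreeTwice H u v i j l k :=
  ⟨by grind [h.nodup], h.2, h.3, h.4, h.5, h.7, h.6⟩

theorem crossingWords_comm : crossingWords H u v i j k l = crossingWords H u v j i k l := by
  ext w
  simp only [crossingWords, Set.mem_ofPred_eq, and_left_comm]

theorem mem_crossingWords (h : AgreeTwice H u v i j k l) (hH : IsIntersecting H) (hw : w ∈ H) :
    w i = u i ∨ w j = u j ∨ w ∈ crossingWords H u v i j k l ∨
      w ∈ crossingWords H u v i j l k := by
  have := hH.eq_or h.nodup hw h.mem_left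
  have := hH.eq_or h.nodup hw h.mem_right
  have := h.eq_fst
  have := h.eq_snd
  have := h.ne_fst
  have := h.ne_snd
  simp only [crossingWords, Set.mem_ofPred_eq]
  grind

theorem crossingWords_nonempty (h : AgreeTwice H u v i j k l) (hs : ¬ HasSmallCover H)
    (hH : IsIntersecting H) : (crossingWords H u v i j k l).Nonempty := by
  obtain ⟨w, hw, hwu⟩ := exists_mem_forall_ne hs hH u k
  have hd := h.nodup
  have := hwu i (by grind)
  have := hwu j (by grind)
  have := hwu l (by grind)
  have := h.mem_crossingWords hH hw
  exact ⟨w, by grind [crossingWords]⟩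

theorem eq_or_eq (h : AgreeTwice H u v i j k l) (hH : IsIntersecting H)
    (hp : p ∈ crossingWords H u v i j k l) (hq : q ∈ crossingWords H u v i j l k) :
    p i = q i ∨ p j = q j := by
  have := hH.eq_or h.nodup hp.1 hq.1
  grind [crossingWords, h.ne_fst, h.ne_snd]

theorem eq_snd_or_eq_snd (h : AgreeTwice H u v i j k l) (hs : ¬ HasSmallCover H)
    (hH : IsIntersecting H) (hp : p ∈ crossingWords H u v i j k l)
    (hq : q ∈ crossingWords H u v i j l k) (hw : w ∈ H) (hwi : w i = u i) (hwj : w j ≠ u j) :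
    w j = p j ∨ w j = q j := by
  have huw : ¬ (w k = u k ∧ w l = u l) := by
    rintro ⟨hk, hl⟩
    refine hwj (congrFun (eq_of_forall_ne_eq (l := j) hs hH hw h.mem_left fun m hm => ?_) j)
    grind [eq_or_of_nodup_four h.nodup m]
  have hvw : ¬ (w k = v k ∧ w l = v l) := by
    rintro ⟨hk, hl⟩
    refine hwj ((congrFun (eq_of_forall_ne_eq (l := j) hs hH hw h.mem_right fun m hm => ?_) j).trans
      h.eq_snd.symm)
    grind [eq_or_of_nodup_four h.nodup m, h.eq_fst]
  have := hH.eq_or h.nodup hw hp.1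
  have := hH.eq_or h.nodup hw hq.1
  have := h.ne_fst
  have := h.ne_snd
  obtain ⟨-, hp⟩ := hp
  obtain ⟨-, hq⟩ := hq
  grind

theorem eq_fst_or_eq_fst (h : AgreeTwice H u v i j k l) (hs : ¬ HasSmallCover H)
    (hH : IsIntersecting H) (hp : p ∈ crossingWords H u v i j k l)
    (hq : q ∈ crossingWords H u v i j l k) (hw : w ∈ H) (hwj : w j = u j) (hwi : w i ≠ u i) :
    w i = p i ∨ w i = q i :=
  h.swap_left.eq_snd_or_eq_snd hs hH (crossingWords_comm ▸ hp) (crossingWords_comm ▸ hq) hw hwj hwi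

-- In this lemma and the next three, a word with at most one of five chosen letters serves as a new
-- crossing word: were it to agree with `u` at `i` or `j`, then the known crossing words would force
-- a second one of the chosen letters on it.
theorem eq_snd_of_eq_fst_of_ne_fst (h : AgreeTwice H u v i j k l) (hs : ¬ HasSmallCover H)
    (hH : IsIntersecting H) (hp : p ∈ crossingWords H u v i j k l)
    (hq : q ∈ crossingWords H u v i j l k) (hp' : p' ∈ crossingWords H u v i j k l)
    (hq' : q' ∈ crossingWords H u v i j l k) (hpq : p i = q i) (hpq' : p' i = q' i)
    (hi : p i ≠ p' i) : p j = q j := by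
  classical
  by_contra hj
  obtain ⟨w, hw, hwS⟩ := exists_of_not_hasSmallCover hs
    (S := {⟨i, u i⟩, ⟨i, p i⟩, ⟨i, p' i⟩, ⟨k, u k⟩, ⟨k, v k⟩}) card_le_five
  simp only [mem_insert, mem_singleton, forall_eq_or_imp, forall_eq] at hwS
  have hik : i ≠ k := by grind [h.nodup]
  have hpq'j := h.eq_or_eq hH hp hq'
  have hp'qj := h.eq_or_eq hH hp' hq
  have hX : w i = u i → w j = u j := by
    intro hwi
    by_contra hwj
    have := h.eq_snd_or_eq_snd hs hH hp hq' hw hwi hwj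
    have := h.eq_snd_or_eq_snd hs hH hp' hq hw hwi hwj
    grind
  have hY : w j = u j → w i = u i := by
    intro hwj
    by_contra hwi
    have := h.eq_fst_or_eq_fst hs hH hp hq hw hwj hwi
    have := h.eq_fst_or_eq_fst hs hH hp' hq' hw hwj hwi
    grind
  have hij : ¬ (w i = u i ∧ w j = u j) := by
    have := hH.eq_or h.nodup hw hp.1
    have := hH.eq_or h.nodup hw hq.1
    grind [crossingWords, h.ne_snd]
  rcases h.mem_crossingWords hH hw with hwi | hwj | hwP | hwQ
  · exact hij ⟨hwi, hX hwi⟩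
  · exact hij ⟨hY hwj, hwj⟩
  · have := h.eq_or_eq hH hwP hq
    have := h.eq_or_eq hH hwP hq'
    grind [crossingWords]
  · have := h.eq_or_eq hH hp hwQ
    have := h.eq_or_eq hH hp' hwQ
    grind [crossingWords]

theorem eq_snd_of_eq_fst_of_ne_snd (h : AgreeTwice H u v i j k l) (hs : ¬ HasSmallCover H)
    (hH : IsIntersecting H) (hp : p ∈ crossingWords H u v i j k l)
    (hq : q ∈ crossingWords H u v i j l k) (hp' : p' ∈ crossingWords H u v i j k l)
    (hq' : q' ∈ crossingWords H u v i j l k) (hpq : p i = q i) (hpj : p j ≠ p' j) :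
    q j = q' j := by
  classical
  by_contra hqj
  obtain ⟨w, hw, hwS⟩ := exists_of_not_hasSmallCover hs
    (S := {⟨i, u i⟩, ⟨j, u j⟩, ⟨i, p i⟩, ⟨k, u k⟩, ⟨k, v k⟩}) card_le_five
  simp only [mem_insert, mem_singleton, forall_eq_or_imp, forall_eq] at hwS
  have hd := h.nodup
  have hik : i ≠ k := by grind
  have hij : i ≠ j := by grind
  have hX : w i = u i → w j = u j := by
    intro hwi
    by_contra hwj
    have := h.eq_snd_or_eq_snd hs hH hp hq hw hwi hwj
    have := h.eq_snd_or_eq_snd hs hH hp hq' hw hwi hwj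
    have := h.eq_snd_or_eq_snd hs hH hp' hq hw hwi hwj
    have := h.eq_snd_or_eq_snd hs hH hp' hq' hw hwi hwj
    grind
  have hY : w j = u j → w i = u i ∨ w i = p i := by
    intro hwj
    by_contra! hwi
    have := h.eq_fst_or_eq_fst hs hH hp hq hw hwj hwi.1
    grind
  have := h.eq_or_eq hH hp hq'
  have := h.eq_or_eq hH hp' hq
  have := h.eq_or_eq hH hp' hq'
  rcases h.mem_crossingWords hH hw with hwi | hwj | hwP | hwQ
  · grind
  · grind
  · have hwi : w i ≠ p i := by grind [crossingWords]
    have := h.eq_or_eq hH hwP hq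
    have := h.eq_or_eq hH hwP hq'
    exact absurd (h.eq_snd_of_eq_fst_of_ne_fst hs hH hp hq hwP hq' hpq (by grind) hwi.symm)
      (by grind)
  · have hwi : w i ≠ p i := by grind [crossingWords]
    have := h.eq_or_eq hH hp hwQ
    have := h.eq_or_eq hH hp' hwQ
    exact absurd (h.eq_snd_of_eq_fst_of_ne_fst hs hH hp hq hp' hwQ hpq (by grind) (by grind))
      (by grind)

theorem eq_snd_of_eq_fst (h : AgreeTwice H u v i j k l) (hs : ¬ HasSmallCover H)
    (hH : IsIntersecting H) (hp : p ∈ crossingWords H u v i j k l)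
    (hq : q ∈ crossingWords H u v i j l k) (hp' : p' ∈ crossingWords H u v i j k l)
    (hpq : p i = q i) : p j = p' j := by
  classical
  by_contra hpj
  obtain ⟨w, hw, hwS⟩ := exists_of_not_hasSmallCover hs
    (S := {⟨i, u i⟩, ⟨j, u j⟩, ⟨i, p i⟩, ⟨j, q j⟩, ⟨k, u k⟩}) card_le_five
  simp only [mem_insert, mem_singleton, forall_eq_or_imp, forall_eq] at hwS
  have hd := h.nodup
  have hik : i ≠ k := by grind
  have hij : i ≠ j := by grind
  have hjk : j ≠ k := by grind
  have hX : w i = u i → w j = u j ∨ w j = q j := by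
    intro hwi
    by_contra! hwj
    have := h.eq_snd_or_eq_snd hs hH hp hq hw hwi hwj.1
    have := h.eq_snd_or_eq_snd hs hH hp' hq hw hwi hwj.1
    grind
  have hY : w j = u j → w i = u i ∨ w i = p i := by
    intro hwj
    by_contra! hwi
    have := h.eq_fst_or_eq_fst hs hH hp hq hw hwj hwi.1
    grind
  rcases h.mem_crossingWords hH hw with hwi | hwj | hwP | hwQ
  · grind
  · grind
  · have := h.eq_or_eq hH hwP hq
    grind [crossingWords]
  · have := h.eq_or_eq hH hp hwQ
    have := h.eq_or_eq hH hp' hwQ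
    have := h.eq_or_eq hH hp' hq
    exact absurd (h.eq_snd_of_eq_fst_of_ne_snd hs hH hp hq hp' hwQ hpq hpj) (by grind)

theorem fst_ne_of_mem_crossingWords (h : AgreeTwice H u v i j k l) (hs : ¬ HasSmallCover H)
    (hH : IsIntersecting H) (hp : p ∈ crossingWords H u v i j k l)
    (hq : q ∈ crossingWords H u v i j l k) : p i ≠ q i := by
  classical
  intro hpq
  obtain ⟨w, hw, hwS⟩ := exists_of_not_hasSmallCover hs
    (S := {⟨i, u i⟩, ⟨j, u j⟩, ⟨i, p i⟩, ⟨j, p j⟩, ⟨j, q j⟩}) card_le_five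
  simp only [mem_insert, mem_singleton, forall_eq_or_imp, forall_eq] at hwS
  have hij : i ≠ j := by grind [h.nodup]
  have hX : w i = u i → w j = u j ∨ w j = p j ∨ w j = q j := by
    intro hwi
    by_contra! hwj
    have := h.eq_snd_or_eq_snd hs hH hp hq hw hwi hwj.1
    grind
  have hY : w j = u j → w i = u i ∨ w i = p i := by
    intro hwj
    by_contra! hwi
    have := h.eq_fst_or_eq_fst hs hH hp hq hw hwj hwi.1
    grind
  rcases h.mem_crossingWords hH hw with hwi | hwj | hwP | hwQ
  · grind
  · grind
  · have := h.eq_or_eq hH hwP hq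
    by_cases hpw : p j = w j
    · have := h.swap_left.eq_snd_of_eq_fst hs hH (crossingWords_comm ▸ hp)
        (crossingWords_comm ▸ hq) (crossingWords_comm ▸ hwP) (by grind)
      grind
    · exact hpw (h.eq_snd_of_eq_fst hs hH hp hq hwP hpq)
  · have := h.eq_or_eq hH hp hwQ
    by_cases hqw : q j = w j
    · have := h.swap_right.swap_left.eq_snd_of_eq_fst hs hH (crossingWords_comm ▸ hq)
        (crossingWords_comm ▸ hp) (crossingWords_comm ▸ hwQ) (by grind)
      grind
    · exact hqw (h.swap_right.eq_snd_of_eq_fst hs hH hq hp hwQ hpq.symm)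

end AgreeTwice

theorem not_agreeTwice (hs : ¬ HasSmallCover H) (hH : IsIntersecting H) {u v : ∀ i, α i} :
    ¬ AgreeTwice H u v i j k l := by
  intro h
  obtain ⟨p, hp⟩ := h.crossingWords_nonempty hs hH
  obtain ⟨q, hq⟩ := h.swap_right.crossingWords_nonempty hs hH
  rcases h.eq_or_eq hH hp hq with hpq | hpq
  · exact h.fst_ne_of_mem_crossingWords hs hH hp hq hpq
  · exact h.swap_left.fst_ne_of_mem_crossingWords hs hH (AgreeTwice.crossingWords_comm ▸ hp)
      (AgreeTwice.crossingWords_comm ▸ hq) hpq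

theorem eq_of_eq_of_eq (hs : ¬ HasSmallCover H) (hH : IsIntersecting H) {u v : ∀ i, α i}
    (hu : u ∈ H) (hv : v ∈ H) (hij : i ≠ j) (hi : u i = v i) (hj : u j = v j) : u = v := by
  obtain ⟨k, l, hd⟩ :=
    (show ∀ {i j : Fin 4}, i ≠ j → ∃ k l, [i, j, k, l].Nodup by decide) hij
  by_cases hk : u k = v k
  · refine eq_of_forall_ne_eq (l := l) hs hH hu hv fun m hm => ?_
    rcases eq_or_of_nodup_four hd m with rfl | rfl | rfl | rfl <;> tauto
  by_cases hl : u l = v l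
  · refine eq_of_forall_ne_eq (l := k) hs hH hu hv fun m hm => ?_
    rcases eq_or_of_nodup_four hd m with rfl | rfl | rfl | rfl <;> tauto
  exact (not_agreeTwice hs hH ⟨hd, hu, hv, hi, hj, hk, hl⟩).elim

end AgreeTwice

section Degree

variable {α : Fin 4 → Type*} [∀ i, DecidableEq (α i)] {s : Finset (∀ i, α i)} {i j : Fin 4}

/-- The number of words of `s` with letter `a` at position `i`. -/
def degree (s : Finset (∀ i, α i)) (i : Fin 4) (a : α i) : ℕ := #{w ∈ s | w i = a}

/-- The letters, with their positions, of degree `d` among those that occur in `s`. -/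
def lettersOfDegree (s : Finset (∀ i, α i)) (d : ℕ) : Finset (Σ i, α i) :=
  univ.sigma fun i => {a ∈ s.image (· i) | degree s i a = d}

theorem mem_lettersOfDegree {d : ℕ} {w : ∀ i, α i} (hw : w ∈ s) :
    ⟨i, w i⟩ ∈ lettersOfDegree s d ↔ degree s i (w i) = d := by
  simp only [lettersOfDegree, mem_sigma, mem_univ, mem_filter, true_and, and_iff_right_iff_imp]
  exact fun _ => mem_image_of_mem _ hw

theorem mul_card_lettersOfDegree (s : Finset (∀ i, α i)) (d : ℕ) :
    d * #(lettersOfDegree s d) = ∑ w ∈ s, #{i | degree s i (w i) = d} := by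
  calc d * #(lettersOfDegree s d)
      = ∑ x ∈ lettersOfDegree s d, #{w ∈ s | w x.1 = x.2} := by
        rw [mul_comm, ← smul_eq_mul, ← sum_const]
        refine sum_congr rfl fun x hx => ?_
        simp only [lettersOfDegree, mem_sigma, mem_filter] at hx
        exact hx.2.2.symm
    _ = ∑ w ∈ s, #{i | ⟨i, w i⟩ ∈ lettersOfDegree s d} :=
        sum_card_filter_apply_eq (lettersOfDegree s d) s id
    _ = ∑ w ∈ s, #{i | degree s i (w i) = d} :=
        sum_congr rfl fun w hw => by simp only [mem_lettersOfDegree hw]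

theorem two_le_degree (hs : ¬ HasSmallCover (s : Set (∀ i, α i)))
    (hH : IsIntersecting (s : Set (∀ i, α i))) {w : ∀ i, α i} (hw : w ∈ s) (i : Fin 4) :
    2 ≤ degree s i (w i) := by
  obtain ⟨v, hv, hvw⟩ := exists_mem_forall_ne hs hH w i
  obtain ⟨m, hm⟩ := hH v hv w hw
  obtain rfl : m = i := by_contra fun h => hvw m h hm
  obtain ⟨n, hn⟩ := exists_ne m
  refine one_lt_card.2 ⟨v, mem_filter.2 ⟨hv, hm⟩, w, mem_filter.2 ⟨hw, rfl⟩, ?_⟩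
  rintro rfl
  exact hvw n hn rfl

theorem degree_le_three (hs : ¬ HasSmallCover (s : Set (∀ i, α i)))
    (hH : IsIntersecting (s : Set (∀ i, α i))) (i : Fin 4) (a : α i) : degree s i a ≤ 3 := by
  obtain ⟨x, hx, hxi⟩ : ∃ x ∈ s, x i ≠ a := by
    contrapose! hs
    exact hasSmallCover_of_forall_eq hs
  have h : ∀ w ∈ ({w ∈ s | w i = a} : Finset _), ∃ m, w m = x m := fun w hw =>
    hH w (mem_filter.1 hw).1 x hx
  choose! m hm using h
  have hcard : #(univ.erase i) = 3 := by simp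
  rw [degree, ← hcard]
  have hmi : ∀ w ∈ ({w ∈ s | w i = a} : Finset _), m w ≠ i := by
    rintro w hw rfl
    exact hxi ((hm w hw).symm.trans (mem_filter.1 hw).2)
  refine card_le_card_of_injOn m (fun w hw => by simpa using hmi w hw) fun v hv w hw hvw => ?_
  obtain ⟨hvs, hvi⟩ := mem_filter.1 (mem_coe.1 hv)
  obtain ⟨hws, hwi⟩ := mem_filter.1 (mem_coe.1 hw)
  refine eq_of_eq_of_eq hs hH hvs hws (hmi v hv).symm (hvi.trans hwi.symm) ?_
  rw [hm v hv, hvw, hm w hw]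

theorem sum_degree (hs : ¬ HasSmallCover (s : Set (∀ i, α i)))
    (hH : IsIntersecting (s : Set (∀ i, α i))) {w : ∀ i, α i} (hw : w ∈ s) :
    ∑ i, degree s i (w i) = #s + 3 := by
  have hone : ∀ v ∈ s.erase w, #{i | v i = w i} = 1 := by
    intro v hv
    obtain ⟨hne, hv⟩ := mem_erase.1 hv
    obtain ⟨i, hi⟩ := hH v hv w hw
    refine card_eq_one.2 ⟨i, eq_singleton_iff_unique_mem.2 ⟨by simpa using hi, fun j hj => ?_⟩⟩
    by_contra hji
    exact hne (eq_of_eq_of_eq hs hH hv hw hji (mem_filter.1 hj).2 hi)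
  calc ∑ i, degree s i (w i) = ∑ v ∈ s, #{i | v i = w i} := by
        simp only [degree, card_filter]
        exact sum_comm
    _ = #{i | w i = w i} + ∑ v ∈ s.erase w, #{i | v i = w i} := (add_sum_erase s _ hw).symm
    _ = 4 + (#s - 1) := by
        rw [sum_congr rfl hone, sum_const, card_erase_of_mem hw]
        simp
    _ = #s + 3 := by
        have := card_pos.2 ⟨w, hw⟩
        omega

theorem card_degree_eq_three (hs : ¬ HasSmallCover (s : Set (∀ i, α i)))
    (hH : IsIntersecting (s : Set (∀ i, α i))) {w : ∀ i, α i} (hw : w ∈ s) :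
    #{i | degree s i (w i) = 3} + 5 = #s := by
  have h : ∀ i, degree s i (w i) = 2 + if degree s i (w i) = 3 then 1 else 0 := by
    intro i
    have := two_le_degree hs hH hw i
    have := degree_le_three hs hH i (w i)
    split <;> omega
  have hsum : ∑ i, degree s i (w i) = 8 + #{i | degree s i (w i) = 3} := by
    rw [sum_congr rfl fun i _ => h i, sum_add_distrib, card_filter]
    simp
  have := sum_degree hs hH hw
  omega

theorem card_degree_eq_two (hs : ¬ HasSmallCover (s : Set (∀ i, α i)))
    (hH : IsIntersecting (s : Set (∀ i, α i))) {w : ∀ i, α i} (hw : w ∈ s) :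
    #{i | degree s i (w i) = 2} + #s = 9 := by
  have h := card_filter_add_card_filter_not (s := (univ : Finset (Fin 4)))
    fun i => degree s i (w i) = 3
  have h' : ∀ i, ¬ degree s i (w i) = 3 ↔ degree s i (w i) = 2 := by
    intro i
    have := two_le_degree hs hH hw i
    have := degree_le_three hs hH i (w i)
    omega
  simp only [h', card_univ, Fintype.card_fin] at h
  have := card_degree_eq_three hs hH hw
  omega

theorem card_eq_nine {α : Fin 4 → Type*} {s : Finset (∀ i, α i)}
    (hs : ¬ HasSmallCover (s : Set (∀ i, α i))) (hH : IsIntersecting (s : Set (∀ i, α i))) :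
    #s = 9 := by
  classical
  obtain ⟨w, hw⟩ : s.Nonempty := by
    by_contra hne
    rw [not_nonempty_iff_eq_empty.1 hne] at hs
    exact hs ⟨2, ∅, by simp [IsCover], .inr (by simp)⟩
  have h₃ : 3 * #(lettersOfDegree s 3) = #s * (#s - 5) := by
    rw [mul_card_lettersOfDegree, ← smul_eq_mul, ← sum_const]
    refine sum_congr rfl fun w hw => ?_
    have := card_degree_eq_three hs hH hw
    omega
  have h₂ : 2 * #(lettersOfDegree s 2) = #s * (9 - #s) := by
    rw [mul_card_lettersOfDegree, ← smul_eq_mul, ← sum_const]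
    refine sum_congr rfl fun w hw => ?_
    have := card_degree_eq_two hs hH hw
    omega
  have hcover₃ : IsCover (#s - 5) (lettersOfDegree s 3) (s : Set (∀ i, α i)) := by
    intro w hw
    refine ⟨({i | degree s i (w i) = 3} : Finset _), ?_, fun i hi => ?_⟩
    · have := card_degree_eq_three hs hH hw
      omega
    · exact (mem_lettersOfDegree hw).2 (mem_filter.1 hi).2
  have hcover₂₃ : IsCover 4 (lettersOfDegree s 2 ∪ lettersOfDegree s 3)
      (s : Set (∀ i, α i)) := by
    intro w hw
    refine ⟨univ, by simp, fun i _ => ?_⟩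
    rw [mem_union, mem_lettersOfDegree hw, mem_lettersOfDegree hw]
    have := two_le_degree hs hH hw i
    have := degree_le_three hs hH i (w i)
    omega
  have hlt₃ : ¬ (2 ≤ #s - 5 ∧ #(lettersOfDegree s 3) < 3 * (#s - 5)) := fun h =>
    hs ⟨_, _, hcover₃, .inr h⟩
  have hlt₂₃ : ¬ (#(lettersOfDegree s 2) + #(lettersOfDegree s 3) < 12) := fun h =>
    hs ⟨_, _, hcover₂₃, .inr ⟨by norm_num, (card_union_le _ _).trans_lt h⟩⟩
  have h5 := card_degree_eq_three hs hH hw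
  have h9 := card_degree_eq_two hs hH hw
  obtain ⟨hlo, hhi⟩ : 5 ≤ #s ∧ #s ≤ 9 := by omega
  generalize #s = m at *
  interval_cases m <;> omega

end Degree

section AffinePlane

variable {α : Fin 4 → Type*}

/-- The constants labelling the lines through a point of the affine plane of order 3, one for each
of the four parallel classes, in the order of the colors of `gyarfas`. -/
def lineCoord (p : ZMod 3 × ZMod 3) : Fin 4 → ZMod 3 := ![p.1, p.2, p.1 + p.2, p.1 - p.2]

/-- Up to injective renaming of letters, the words of `H` are the points of the affine plane of
order 3, each written as the list of the four lines through it. -/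
def IsAffinePlane (H : Set (∀ i, α i)) : Prop :=
  ∃ φ : ∀ i, ZMod 3 → α i, (∀ i, Function.Injective (φ i)) ∧
    H = Set.range fun p i => φ i (lineCoord p i)

/-- An orthogonal array of strength 2 and index 1 with three levels: three letters occur at each
position, and any pair of them at two given positions occurs in exactly one word. -/
structure IsOrthogonalArray [∀ i, DecidableEq (α i)] (s : Finset (∀ i, α i)) : Prop where
  nonempty : s.Nonempty
  card_image : ∀ i, #(s.image (· i)) = 3
  exists_mem : ∀ {i j}, i ≠ j → ∀ u ∈ s, ∀ v ∈ s, ∃ w ∈ s, w i = u i ∧ w j = v j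
  ext : ∀ {i j}, i ≠ j → ∀ u ∈ s, ∀ v ∈ s, u i = v i → u j = v j → u = v

theorem eq_add_of_injective {f : ZMod 3 → ZMod 3 → ZMod 3} (h₁ : ∀ x, f x 0 = x)
    (h₂ : ∀ y, f 0 y = y) (hl : ∀ x, (f x).Injective) (hr : ∀ y, (f · y).Injective)
    (x y : ZMod 3) : f x y = x + y := by
  have hne : ∀ x y, x ≠ 0 → y ≠ 0 → x ≠ y → f x y = x + y := by
    intro x y hx hy hxy
    have hfx : f x y ≠ x := fun h => hy (hl x (h.trans (h₁ x).symm))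
    have hfy : f x y ≠ y := fun h => hx (hr y (h.trans (h₂ y).symm))
    have hkey : ∀ x y z : ZMod 3, x ≠ 0 → y ≠ 0 → x ≠ y → z ≠ x → z ≠ y → z = x + y := by decide
    exact hkey x y _ hx hy hxy hfx hfy
  by_cases hx : x = 0
  · rw [hx, h₂, zero_add]
  by_cases hy : y = 0
  · rw [hy, h₁, add_zero]
  by_cases hxy : x = y
  · have hkey : ∀ x z : ZMod 3, x ≠ 0 → z ≠ x → z ≠ x + -x → z = x + x := by decide
    have hneg : ∀ x : ZMod 3, x ≠ 0 → x ≠ -x := by decide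
    rw [← hxy]
    refine hkey x _ hx (fun h => hx (hl x (h.trans (h₁ x).symm))) ?_
    rw [← hne x (-x) hx (neg_ne_zero.2 hx) (hneg x hx)]
    exact (hl x).ne (hneg x hx)
  · exact hne x y hx hy hxy

theorem eq_sub_of_orthogonal {g : ZMod 3 → ZMod 3 → ZMod 3} (h₁ : ∀ x, g x 0 = x)
    (hl : ∀ x, (g x).Injective)
    (hg : ∀ x y x' y', x + y = x' + y' → g x y = g x' y' → x = x') (x y : ZMod 3) :
    g x y = x - y := by
  by_cases hy : y = 0
  · rw [hy, h₁, sub_zero]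
  have hx : g x y ≠ x := fun h => hy (hl x (h.trans (h₁ x).symm))
  have hxy : g x y ≠ x + y := fun h =>
    hy (left_eq_add.1 (hg x y (x + y) 0 (add_zero _).symm (h.trans (h₁ _).symm)))
  have hkey : ∀ x y z : ZMod 3, y ≠ 0 → z ≠ x → z ≠ x + y → z = x - y := by decide
  exact hkey x y _ hy hx hxy

namespace IsOrthogonalArray

variable [∀ i, DecidableEq (α i)] {s : Finset (∀ i, α i)} {i j k : Fin 4}

theorem exists_eq_of_injective (h : IsOrthogonalArray s) {W : ZMod 3 → ∀ i, α i}
    (hW : ∀ z, W z ∈ s) (hinj : Function.Injective fun z => W z i) {w : ∀ i, α i} (hw : w ∈ s) :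
    ∃ z, w i = W z i := by
  have hsub : univ.image (fun z => W z i) ⊆ s.image fun w => w i :=
    image_subset_iff.2 fun z _ => mem_image_of_mem (· i) (hW z)
  have heq := eq_of_subset_of_card_le hsub
    (by rw [h.card_image, card_image_of_injective _ hinj, card_univ, ZMod.card])
  obtain ⟨z, -, hz⟩ := mem_image.1 (heq ▸ mem_image_of_mem (fun w : ∀ i, α i => w i) hw)
  exact ⟨z, hz.symm⟩

theorem injective_of_forall_eq (h : IsOrthogonalArray s) {W : ZMod 3 → ∀ i, α i}
    (hW : ∀ z, W z ∈ s) (hi : Function.Injective fun z => W z i) (hjk : j ≠ k)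
    (hj : ∀ z z', W z j = W z' j) : Function.Injective fun z => W z k :=
  fun z z' hz => hi (congrFun (h.ext hjk _ (hW z) _ (hW z') (hj z z') hz) i)

-- `X` and `Y` run through the axes `y = 0` and `x = 0`, matched along the lines `x + y = z`.
theorem exists_axes (h : IsOrthogonalArray s) : ∃ X Y : ZMod 3 → ∀ i, α i,
    (∀ z, X z ∈ s) ∧ (∀ z, Y z ∈ s) ∧ X 0 = Y 0 ∧ (∀ z, X z 1 = X 0 1) ∧
      (∀ z, Y z 0 = X 0 0) ∧ (∀ z, Y z 2 = X z 2) ∧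
      (∀ k ≠ 1, Function.Injective fun z => X z k) ∧ Function.Injective fun z => Y z 1 := by
  obtain ⟨o, ho⟩ := h.nonempty
  obtain ⟨e⟩ : Nonempty (ZMod 3 ≃ s.image (· 0)) :=
    ⟨Fintype.equivOfCardEq (by rw [ZMod.card, Fintype.card_coe, h.card_image])⟩
  choose V hV hVe using fun z => mem_image.1 (e z).2
  choose X hX hX0 hX1 using fun z => h.exists_mem zero_ne_one (V z) (hV z) o ho
  have hX1' : ∀ z z', X z 1 = X z' 1 := fun z z' => (hX1 z).trans (hX1 z').symm
  have hinj0 : Function.Injective fun z => X z 0 := fun z z' hz =>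
    e.injective (Subtype.ext (by rw [← hVe, ← hVe, ← hX0, ← hX0]; exact hz))
  have hinj : ∀ k ≠ 1, Function.Injective fun z => X z k := fun k hk =>
    h.injective_of_forall_eq hX hinj0 hk.symm hX1'
  choose Y hY hY0 hY2 using fun z =>
    h.exists_mem (by decide : (0 : Fin 4) ≠ 2) (X 0) (hX 0) (X z) (hX z)
  refine ⟨X, Y, hX, hY, ?_, fun z => hX1' z 0, hY0, hY2, hinj, ?_⟩
  · exact h.ext (by decide : (0 : Fin 4) ≠ 2) _ (hX 0) _ (hY 0) (hY0 0).symm (hY2 0).symm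
  · refine h.injective_of_forall_eq (i := 2) hY ?_ zero_ne_one
      fun z z' => (hY0 z).trans (hY0 z').symm
    simpa only [hY2] using hinj 2 (by decide)

theorem exists_coordinates (h : IsOrthogonalArray s) :
    ∃ φ : ∀ i, ZMod 3 → α i, (∀ i, Function.Injective (φ i)) ∧
      ∀ p, (fun i => φ i (lineCoord p i)) ∈ s := by
  obtain ⟨X, Y, hX, hY, hXY, hX1, hY0, hY2, hXinj, hYinj⟩ := h.exists_axes
  choose W hW hW0 hW1 using fun x y => h.exists_mem zero_ne_one (X x) (hX x) (Y y) (hY y)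
  have hWX : ∀ x, W x 0 = X x := fun x =>
    h.ext zero_ne_one _ (hW x 0) _ (hX x) (hW0 x 0) (by rw [hW1, hX1, hXY])
  have hWY : ∀ y, W 0 y = Y y := fun y =>
    h.ext zero_ne_one _ (hW 0 y) _ (hY y) (by rw [hW0, hY0]) (hW1 0 y)
  have hcol : ∀ x, ∀ k ≠ 0, Function.Injective fun y => W x y k := fun x k hk =>
    h.injective_of_forall_eq (i := 1) (hW x) (by simpa only [hW1] using hYinj) hk.symm
      fun y y' => (hW0 x y).trans (hW0 x y').symm
  have hrow : ∀ y, ∀ k ≠ 1, Function.Injective fun x => W x y k := fun y k hk =>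
    h.injective_of_forall_eq (i := 0) (hW · y) (by simpa only [hW0] using hXinj 0 zero_ne_one)
      hk.symm fun x x' => (hW1 x y).trans (hW1 x' y).symm
  have hWk : ∀ k ≠ 1, ∀ x y, ∃ z, W x y k = X z k := fun k hk x y =>
    h.exists_eq_of_injective hX (hXinj k hk) (hW x y)
  choose f hf using hWk 2 (by decide)
  choose g hg using hWk 3 (by decide)
  have hfadd : ∀ x y, f x y = x + y := eq_add_of_injective
    (fun x => hXinj 2 (by decide) (by simp only [← hf, hWX]))
    (fun y => hXinj 2 (by decide) (by simp only [← hf, hWY, hY2]))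
    (fun x y y' e => hcol x 2 (by decide) (by simp only [hf, e]))
    (fun y x x' (e : f x y = f x' y) => hrow y 2 (by decide) (by simp only [hf, e]))
  have hgsub : ∀ x y, g x y = x - y := by
    refine eq_sub_of_orthogonal (fun x => hXinj 3 (by decide) (by simp only [← hg, hWX]))
      (fun x y y' e => hcol x 3 (by decide) (by simp only [hg, e]))
      fun x y x' y' h₂ h₃ => hXinj 0 zero_ne_one ?_
    have hWW : W x y = W x' y' := h.ext (by decide : (2 : Fin 4) ≠ 3) _ (hW x y) _ (hW x' y')
      (by rw [hf, hf, hfadd, hfadd, h₂]) (by rw [hg, hg, h₃])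
    exact (hW0 x y).symm.trans ((congrFun hWW 0).trans (hW0 x' y'))
  refine ⟨fun i z => ![X, Y, X, X] i z i, fun i => ?_, fun p => ?_⟩
  · fin_cases i
    exacts [hXinj 0 (by decide), hYinj, hXinj 2 (by decide), hXinj 3 (by decide)]
  · convert hW p.1 p.2 with i
    fin_cases i
    · exact (hW0 p.1 p.2).symm
    · exact (hW1 p.1 p.2).symm
    · exact (congrArg (X · 2) (hfadd p.1 p.2)).symm.trans (hf p.1 p.2).symm
    · exact (congrArg (X · 3) (hgsub p.1 p.2)).symm.trans (hg p.1 p.2).symm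

theorem isAffinePlane (h : IsOrthogonalArray s) : IsAffinePlane (s : Set (∀ i, α i)) := by
  obtain ⟨φ, hφ, hmem⟩ := h.exists_coordinates
  refine ⟨φ, hφ, Set.Subset.antisymm (fun w hw => ?_) (Set.range_subset_iff.2 hmem)⟩
  obtain ⟨x, hx⟩ := h.exists_eq_of_injective (i := 0) (fun z => hmem (z, 0)) (hφ 0) hw
  obtain ⟨y, hy⟩ := h.exists_eq_of_injective (i := 1) (fun z => hmem (0, z)) (hφ 1) hw
  exact ⟨(x, y), h.ext zero_ne_one _ (hmem (x, y)) _ hw hx.symm hy.symm⟩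

end IsOrthogonalArray

theorem isOrthogonalArray [∀ i, DecidableEq (α i)] {s : Finset (∀ i, α i)}
    (hs : ¬ HasSmallCover (s : Set (∀ i, α i)))
    (hH : IsIntersecting (s : Set (∀ i, α i))) : IsOrthogonalArray s := by
  have hcard := card_eq_nine hs hH
  have hdeg : ∀ w ∈ s, ∀ i, degree s i (w i) = 3 := by
    intro w hw i
    have hfour : #{i | degree s i (w i) = 3} = #(univ : Finset (Fin 4)) := by
      have := card_degree_eq_three hs hH hw
      rw [card_univ, Fintype.card_fin]
      omega
    exact filter_card_eq hfour i (mem_univ i)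
  have himage : ∀ i, #(s.image (· i)) = 3 := by
    intro i
    have := card_eq_sum_card_image (· i) s
    rw [sum_congr rfl (g := fun _ => 3) (by
      simp only [mem_image]
      rintro _ ⟨w, hw, rfl⟩
      exact hdeg w hw i), sum_const, smul_eq_mul] at this
    omega
  refine ⟨card_pos.1 (by omega), himage, fun {i j} hij u hu v hv => ?_,
    fun hij u hu v hv => eq_of_eq_of_eq hs hH hu hv hij⟩
  have hinj : Set.InjOn (fun w : ∀ i, α i => w j) ↑({w ∈ s | w i = u i} : Finset (∀ i, α i)) := by
    intro x hx y hy hxy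
    simp only [coe_filter, Set.mem_ofPred_eq] at hx hy
    exact eq_of_eq_of_eq hs hH hx.1 hy.1 hij (hx.2.trans hy.2.symm) hxy
  have heq := eq_of_subset_of_card_le (image_subset_image (f := fun w : ∀ i, α i => w j)
    (filter_subset (fun w => w i = u i) s))
    (by rw [card_image_of_injOn hinj, himage]; exact (hdeg u hu i).ge)
  obtain ⟨w, hw, hwj⟩ := mem_image.1 (heq ▸ mem_image_of_mem (fun w : ∀ i, α i => w j) hv)
  exact ⟨w, (mem_filter.1 hw).1, (mem_filter.1 hw).2, hwj⟩

theorem hasSmallCover_or_isAffinePlane {H : Set (∀ i, α i)} (hfin : H.Finite)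
    (hH : IsIntersecting H) : HasSmallCover H ∨ IsAffinePlane H := by
  classical
  lift H to Finset (∀ i, α i) using hfin
  exact or_iff_not_imp_left.2 fun hs => (isOrthogonalArray hs hH).isAffinePlane

end AffinePlane

theorem IsAffinePlane.exists_isCover {α : Fin 4 → Type*} {H : Set (∀ i, α i)}
    (h : IsAffinePlane H) : ∃ S, IsCover 4 S H ∧ #S ≤ 12 := by
  classical
  obtain ⟨φ, -, rfl⟩ := h
  refine ⟨univ.image fun x : Fin 4 × ZMod 3 => ⟨x.1, φ x.1 x.2⟩, ?_, card_image_le⟩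
  rintro _ ⟨p, rfl⟩
  exact ⟨univ, le_rfl, fun i _ => mem_image.2 ⟨(i, lineCoord p i), mem_univ _, rfl⟩⟩

section Profile

variable {V W K : Type*}

/-- The word of a vertex: its letter at position `k` is the component of color `k` through it. -/
def profile (c : TopEdgeLabeling V K) (v : V) (k : K) : (c.labelGraph k).ConnectedComponent :=
  (c.labelGraph k).connectedComponentMk v

theorem profile_get_eq (c : TopEdgeLabeling V K) {u v : V} (h : u ≠ v) :
    profile c u (c.get u v h) = profile c v (c.get u v h) :=
  ConnectedComponent.sound ((TopEdgeLabeling.labelGraph_adj u v).2 ⟨h, rfl⟩).reachable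

theorem isIntersecting_range_profile [Nonempty K] (c : TopEdgeLabeling V K) :
    IsIntersecting (Set.range (profile c)) := by
  rintro _ ⟨u, rfl⟩ _ ⟨v, rfl⟩
  by_cases h : u = v
  · exact ⟨Classical.arbitrary K, by rw [h]⟩
  · exact ⟨c.get u v h, profile_get_eq c h⟩

theorem surjective_of_range_profile_eq {β : K → Type*} {P : Type*} {c : TopEdgeLabeling V K}
    {φ : ∀ k, β k → (c.labelGraph k).ConnectedComponent} {g : P → ∀ k, β k}
    (h : Set.range (profile c) = Set.range fun p k => φ k (g p k)) (k : K) :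
    Function.Surjective (φ k) := by
  refine ConnectedComponent.ind fun v => ?_
  obtain ⟨p, hp⟩ := h.le ⟨v, rfl⟩
  exact ⟨g p k, congrFun hp k⟩

theorem nonempty_iInter_verts (c : TopEdgeLabeling V K) (S : Set (MonoComponent c)) :
    (⋂ C ∈ S, C.verts).Nonempty ↔ ∃ v, ∀ C ∈ S, profile c v C.1 = C.2 := by
  simp only [Set.Nonempty, Set.mem_iInter]
  rfl

theorem sameComponentStructure_of_equiv {c : TopEdgeLabeling V K} {d : TopEdgeLabeling W K}
    (e : ∀ k, (c.labelGraph k).ConnectedComponent ≃ (d.labelGraph k).ConnectedComponent)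
    (h : Set.range (fun v k => e k (profile c v k)) = Set.range (profile d)) :
    SameComponentStructure c d := by
  let f : MonoComponent c ≃ MonoComponent d := Equiv.sigmaCongrRight e
  refine ⟨1, f, fun _ => rfl, fun S => ?_⟩
  have hS : (⋂ C ∈ S, (f C).verts).Nonempty ↔
      ∃ w ∈ Set.range (profile d), ∀ C ∈ S, w C.1 = e C.1 C.2 := by
    simp only [Set.exists_range_iff, Set.Nonempty, Set.mem_iInter]
    rfl
  rw [nonempty_iInter_verts, hS, ← h]
  simp only [Set.exists_range_iff, EmbeddingLike.apply_eq_iff_eq]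

theorem sameComponentStructure_of_isAffinePlane {c : TopEdgeLabeling V (Fin 4)}
    {d : TopEdgeLabeling W (Fin 4)} (hc : IsAffinePlane (Set.range (profile c)))
    (hd : IsAffinePlane (Set.range (profile d))) : SameComponentStructure c d := by
  obtain ⟨φ, hφ, hc⟩ := hc
  obtain ⟨ψ, hψ, hd⟩ := hd
  have hφ k : Function.Bijective (φ k) := ⟨hφ k, surjective_of_range_profile_eq hc k⟩
  have hψ k : Function.Bijective (ψ k) := ⟨hψ k, surjective_of_range_profile_eq hd k⟩
  let e k := (Equiv.ofBijective _ (hφ k)).symm.trans (Equiv.ofBijective _ (hψ k))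
  have he : ∀ k z, e k (φ k z) = ψ k z := fun k z =>
    congrArg (ψ k) (Equiv.ofBijective_symm_apply_apply (φ k) _ z)
  refine sameComponentStructure_of_equiv e ?_
  have := congrArg (Set.image fun w k => e k (w k)) hc
  simpa only [← Set.range_comp, Function.comp_def, he, ← hd] using this

theorem profile_gyarfas_eq_iff {p q : ZMod 3 × ZMod 3} {i : Fin 4} :
    profile gyarfas p i = profile gyarfas q i ↔ lineCoord p i = lineCoord q i := by
  constructor
  · intro h
    obtain ⟨w⟩ := ConnectedComponent.exact h
    clear h
    induction w with
    | nil => rfl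
    | cons hvw _ ih => exact ((gyarfas_adj i _ _).1 hvw).2.trans ih
  · intro h
    by_cases hpq : p = q
    · rw [hpq]
    · exact ConnectedComponent.sound ((gyarfas_adj i p q).2 ⟨hpq, h⟩).reachable

theorem isAffinePlane_gyarfas : IsAffinePlane (Set.range (profile gyarfas)) := by
  choose P hP using (by decide : ∀ i z, ∃ p, lineCoord p i = z)
  refine ⟨fun i z => profile gyarfas (P i z) i, fun i z z' h => ?_, ?_⟩
  · rw [← hP i z, ← hP i z', profile_gyarfas_eq_iff.1 h]
  · exact congrArg Set.range
      (funext fun p => funext fun i => profile_gyarfas_eq_iff.2 (hP i _).symm)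

end Profile

section Counting

variable {V K : Type*} [Fintype V]

/-- The number of vertices of a monochromatic component. -/
noncomputable def MonoComponent.order {c : TopEdgeLabeling V K} (C : MonoComponent c) : ℕ :=
  C.verts.ncard

theorem MonoComponent.order_eq_card {c : TopEdgeLabeling V K} (C : MonoComponent c)
    [DecidableEq (c.labelGraph C.1).ConnectedComponent] :
    C.order = #{v | profile c v C.1 = C.2} := by
  rw [order, ← Set.ncard_coe_finset]
  congr 1
  ext v
  simp only [coe_filter, mem_univ, true_and]
  rfl

theorem MonoComponent.numEdges_le_choose {V : Type*} [Finite V] {c : TopEdgeLabeling V K}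
    (C : MonoComponent c) : C.numEdges ≤ C.order.choose 2 := by
  classical
  have := Fintype.ofFinite V
  have h := card_edgeFinset_le_card_choose_two (G := C.2.toSimpleGraph)
  rw [numEdges, order, Set.ncard_eq_toFinset_card', Set.ncard_eq_toFinset_card',
    Set.toFinset_card C.verts]
  convert h
  · ext e
    simp
  · rfl

instance {V : Type*} [Finite V] [Finite K] (c : TopEdgeLabeling V K) : Finite (MonoComponent c) :=
  inferInstanceAs (Finite (Σ k : K, (c.labelGraph k).ConnectedComponent))

theorem choose_two_le_sum_numEdges (c : TopEdgeLabeling V K) [Fintype (MonoComponent c)] :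
    (Fintype.card V).choose 2 ≤ ∑ C : MonoComponent c, C.numEdges := by
  classical
  have hsub : (⊤ : SimpleGraph V).edgeFinset ⊆ univ.biUnion fun C : MonoComponent c =>
      C.2.toSimpleGraph.edgeSet.toFinset.image (Sym2.map Subtype.val) := by
    intro e he
    induction e using Sym2.inductionOn with
    | hf x y =>
      rw [mem_edgeFinset, mem_edgeSet] at he
      have hadj : (c.labelGraph (c.get x y he)).Adj x y :=
        (TopEdgeLabeling.labelGraph_adj x y).2 ⟨he, rfl⟩
      simp only [mem_biUnion, mem_univ, true_and, mem_image, Set.mem_toFinset]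
      refine ⟨⟨_, profile c x (c.get x y he)⟩,
        s(⟨x, ConnectedComponent.connectedComponentMk_mem⟩, ⟨y, (profile_get_eq c he).symm⟩),
        ?_, rfl⟩
      rw [mem_edgeSet]
      exact (ConnectedComponent.toSimpleGraph_adj _ _ _).2 hadj
  rw [← card_edgeFinset_top_eq_card_choose_two]
  refine (card_le_card hsub).trans (card_biUnion_le.trans (sum_le_sum fun C _ => ?_))
  rw [MonoComponent.numEdges, Set.ncard_eq_toFinset_card']
  exact card_image_le

theorem sum_order_add_le [Fintype K] {c : TopEdgeLabeling V K} [Fintype (MonoComponent c)]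
    [DecidableEq (MonoComponent c)] {S : Finset (MonoComponent c)}
    {t : ℕ} (hS : IsCover t S (Set.range (profile c))) :
    ∑ C ∈ Sᶜ, C.order + t * Fintype.card V ≤ Fintype.card K * Fintype.card V := by
  classical
  have hv : ∀ v, #{k | (⟨k, profile c v k⟩ : MonoComponent c) ∈ Sᶜ} + t ≤ Fintype.card K := by
    intro v
    obtain ⟨I, hI, hIS⟩ := hS _ ⟨v, rfl⟩
    have hdisj : Disjoint ({k | (⟨k, profile c v k⟩ : MonoComponent c) ∈ Sᶜ} : Finset K) I :=
      disjoint_left.2 fun k hk hkI => mem_compl.1 (mem_filter.1 hk).2 (hIS k hkI)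
    have := card_le_univ (({k | (⟨k, profile c v k⟩ : MonoComponent c) ∈ Sᶜ} : Finset K) ∪ I)
    rw [card_union_of_disjoint hdisj] at this
    omega
  calc ∑ C ∈ Sᶜ, C.order + t * Fintype.card V
      = ∑ v, (#{k | (⟨k, profile c v k⟩ : MonoComponent c) ∈ Sᶜ} + t) := by
        rw [sum_congr rfl fun C _ => C.order_eq_card,
          sum_card_filter_apply_eq Sᶜ univ (profile c), sum_add_distrib, sum_const, card_univ,
          smul_eq_mul, mul_comm]
    _ ≤ ∑ _v : V, Fintype.card K := sum_le_sum fun v _ => hv v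
    _ = Fintype.card K * Fintype.card V := by rw [sum_const, card_univ, smul_eq_mul, mul_comm]

theorem MonoComponent.mul_numEdges_le {c : TopEdgeLabeling V K} (C : MonoComponent c) {ρ : ℝ}
    (hρ : 1 ≤ ρ) (hn : 1 ≤ Fintype.card V)
    (h : C.numEdges * ρ ^ 2 ≤ (Fintype.card V).choose 2) :
    ρ * (2 * C.numEdges) ≤ C.order * (Fintype.card V - 1) := by
  have hC : (C.numEdges : ℝ) ≤ C.order.choose 2 := by exact_mod_cast C.numEdges_le_choose
  have hn : (1 : ℝ) ≤ Fintype.card V := by exact_mod_cast hn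
  rw [Nat.cast_choose_two] at hC h
  -- Components of order at most `(n - 1) / ρ + 1` have few edges for lack of vertices.
  rcases le_total (ρ * (C.order - 1)) (Fintype.card V - 1) with hm | hm
  · calc ρ * (2 * C.numEdges) ≤ ρ * (C.order * (C.order - 1)) :=
          mul_le_mul_of_nonneg_left (by linarith) (by linarith)
      _ = C.order * (ρ * (C.order - 1)) := by ring
      _ ≤ C.order * (Fintype.card V - 1) := by gcongr
  · refine le_of_mul_le_mul_left ?_ (zero_lt_one.trans_le hρ)
    calc ρ * (ρ * (2 * C.numEdges)) = 2 * (C.numEdges * ρ ^ 2) := by ring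
      _ ≤ Fintype.card V * (Fintype.card V - 1) := by linarith
      _ ≤ (ρ * C.order) * (Fintype.card V - 1) := by gcongr; linarith
      _ = ρ * (C.order * (Fintype.card V - 1)) := by ring

theorem exists_numEdges_ge_of_isCover [Fintype K] [Nonempty V] {c : TopEdgeLabeling V K} {t : ℕ}
    {S : Finset (MonoComponent c)} (hS : IsCover t S (Set.range (profile c))) (ht : 1 ≤ t) {ρ : ℝ}
    (hρ : 1 ≤ ρ) (h : #S + (Fintype.card K - t) * ρ ≤ ρ ^ 2) :
    ∃ C : MonoComponent c, (Fintype.card V).choose 2 / ρ ^ 2 ≤ (C.numEdges : ℝ) := by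
  classical
  have := Fintype.ofFinite (MonoComponent c)
  by_contra! hlt
  have hlt : ∀ C : MonoComponent c, C.numEdges * ρ ^ 2 < (Fintype.card V).choose 2 := fun C =>
    (lt_div_iff₀ (by positivity)).1 (hlt C)
  set n := Fintype.card V
  have hn1 : (1 : ℝ) ≤ n := by exact_mod_cast Fintype.card_pos
  have hSne : S.Nonempty := by
    obtain ⟨I, hI, hIS⟩ := hS _ ⟨Classical.arbitrary V, rfl⟩
    obtain ⟨k, hk⟩ := card_pos.1 (ht.trans hI)
    exact ⟨_, hIS k hk⟩
  have hin : ∑ C ∈ S, C.numEdges * ρ ^ 2 < #S * n.choose 2 := by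
    rw [← nsmul_eq_mul, ← sum_const]
    exact sum_lt_sum_of_nonempty hSne fun C _ => hlt C
  have hout : ∑ C ∈ Sᶜ, ρ * (2 * C.numEdges) ≤ (Fintype.card K - t) * n * (n - 1) := by
    have hsum : ∑ C ∈ Sᶜ, (C.order : ℝ) + t * n ≤ Fintype.card K * n := by
      exact_mod_cast sum_order_add_le hS
    calc ∑ C ∈ Sᶜ, ρ * (2 * C.numEdges) ≤ ∑ C ∈ Sᶜ, (C.order : ℝ) * (n - 1) :=
          sum_le_sum fun C _ => C.mul_numEdges_le hρ Fintype.card_pos (hlt C).le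
      _ ≤ (Fintype.card K - t) * n * (n - 1) := by
          rw [← sum_mul]
          gcongr
          linarith
  have hall : (n.choose 2 : ℝ) ≤ ∑ C ∈ S, (C.numEdges : ℝ) + ∑ C ∈ Sᶜ, (C.numEdges : ℝ) := by
    rw [sum_add_sum_compl]
    exact_mod_cast choose_two_le_sum_numEdges c
  rw [← sum_mul] at hin
  rw [← mul_sum, ← mul_sum] at hout
  have hchoose : 2 * (n.choose 2 : ℝ) = n * (n - 1) := by rw [Nat.cast_choose_two]; ring
  have : (#S + (Fintype.card K - t) * ρ) * (n.choose 2) ≤ ρ ^ 2 * n.choose 2 := by gcongr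
  have := mul_le_mul_of_nonneg_left hout (zero_le_one.trans hρ)
  have := mul_le_mul_of_nonneg_right hall (sq_nonneg ρ)
  nlinarith

end Counting

theorem fourteen_add_sqrt_eq : 14 + √96 = 2 * (1 + √6) ^ 2 := by
  have h : √96 = 4 * √6 := by
    rw [show (96 : ℝ) = 4 ^ 2 * 6 by norm_num, Real.sqrt_mul (by norm_num),
      Real.sqrt_sq (by norm_num)]
  have := Real.sq_sqrt (show (0 : ℝ) ≤ 6 by norm_num)
  rw [h]
  linear_combination -2 * this

theorem one_div_twelve_add_lt : (1 / 12 + 0.0007 : ℝ) < 2 / (14 + √96) := by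
  have h : √96 < 9.798 := (Real.sqrt_lt' (by norm_num)).2 (by norm_num)
  rw [lt_div_iff₀ (by positivity)]
  linarith

section FourColors

variable {V : Type*} [Fintype V] [Nonempty V] {c : TopEdgeLabeling V (Fin 4)}

theorem exists_numEdges_ge_of_isAffinePlane (h : IsAffinePlane (Set.range (profile c))) :
    ∃ C : MonoComponent c, 1 / 12 * (Fintype.card V).choose 2 ≤ (C.numEdges : ℝ) := by
  obtain ⟨S, hS, hcard⟩ := h.exists_isCover
  have hsq : √12 ^ 2 = 12 := Real.sq_sqrt (by norm_num)
  have hcard : (#S : ℝ) ≤ 12 := by exact_mod_cast hcard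
  obtain ⟨C, hC⟩ := exists_numEdges_ge_of_isCover (ρ := √12) hS (by norm_num)
    (Real.one_le_sqrt.2 (by norm_num)) (by simpa [hsq] using hcard)
  exact ⟨C, by rwa [one_div_mul_eq_div, ← hsq]⟩

theorem exists_numEdges_ge_of_hasSmallCover (h : HasSmallCover (Set.range (profile c))) :
    ∃ C : MonoComponent c, 2 / (14 + √96) * (Fintype.card V).choose 2 ≤ (C.numEdges : ℝ) := by
  obtain ⟨t, S, hS, hcard⟩ := h
  obtain ⟨I, hI, -⟩ := hS _ ⟨Classical.arbitrary V, rfl⟩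
  have ht : t ≤ 4 := hI.trans (card_le_univ I)
  have hsq : √6 ^ 2 = 6 := Real.sq_sqrt (by norm_num)
  have hlo : 2 ≤ √6 := Real.le_sqrt_of_sq_le (by norm_num)
  have hhi : √6 ≤ 3 := Real.sqrt_le_iff.2 (by norm_num)
  -- `1 + √6` is the positive root of `ρ ^ 2 = 5 + 2 * ρ`, the critical case `t = 2`, `#S = 5`.
  obtain ⟨C, hC⟩ := exists_numEdges_ge_of_isCover (ρ := 1 + √6) hS (by omega) (by linarith) (by
    rw [Fintype.card_fin]
    rcases hcard with ⟨rfl, hcard⟩ | ⟨ht2, hcard⟩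
    · rw [hcard]
      push_cast
      nlinarith
    · have ht2 : (2 : ℝ) ≤ t := by exact_mod_cast ht2
      have hcard : (#S : ℝ) + 1 ≤ 3 * t := by exact_mod_cast hcard
      push_cast
      nlinarith)
  refine ⟨C, le_of_eq_of_le ?_ hC⟩
  rw [fourteen_add_sqrt_eq]
  field_simp

theorem hasSmallCover_of_not_sameComponentStructure {V : Type*} [Finite V]
    {c : TopEdgeLabeling V (Fin 4)} (h : ¬ SameComponentStructure c gyarfas) :
    HasSmallCover (Set.range (profile c)) :=
  (hasSmallCover_or_isAffinePlane (Set.finite_range _)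
    (isIntersecting_range_profile c)).resolve_right fun hc =>
      h (sameComponentStructure_of_isAffinePlane hc isAffinePlane_gyarfas)

theorem exists_numEdges_ge (c : TopEdgeLabeling V (Fin 4)) :
    ∃ C : MonoComponent c, 1 / 12 * (Fintype.card V).choose 2 ≤ (C.numEdges : ℝ) := by
  rcases hasSmallCover_or_isAffinePlane (Set.finite_range _) (isIntersecting_range_profile c)
    with hc | hc
  · obtain ⟨C, hC⟩ := exists_numEdges_ge_of_hasSmallCover hc
    exact ⟨C, hC.trans' (mul_le_mul_of_nonneg_right (by linarith [one_div_twelve_add_lt])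
      (Nat.cast_nonneg _))⟩
  · exact exists_numEdges_ge_of_isAffinePlane hc

end FourColors

end ColoredComponents

theorem theorem1p2 (n : ℕ) (hn : 1 ≤ n) :
    (∀ c : SimpleGraph.TopEdgeLabeling (Fin n) (Fin 4),
      ∃ C : ColoredComponents.MonoComponent c,
        (1 / 12 : ℝ) * (n.choose 2 : ℝ) ≤ (C.numEdges : ℝ)) ∧
    ⌈(1 / 12 : ℝ) * (n.choose 2 : ℝ)⌉₊ ≤ ColoredComponents.M n 4 ∧
    (∀ c : SimpleGraph.TopEdgeLabeling (Fin n) (Fin 4),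
      ¬ ColoredComponents.SameComponentStructure c ColoredComponents.gyarfas →
      ∃ C : ColoredComponents.MonoComponent c,
        (2 / (14 + √96) : ℝ) * (n.choose 2 : ℝ) ≤ (C.numEdges : ℝ)) ∧
    (1 / 12 + 0.0007 : ℝ) < 2 / (14 + √96) := by
  have : Nonempty (Fin n) := ⟨⟨0, hn⟩⟩
  have h (c : SimpleGraph.TopEdgeLabeling (Fin n) (Fin 4)) :
      ∃ C : ColoredComponents.MonoComponent c, (1 / 12 : ℝ) * (n.choose 2 : ℝ) ≤ C.numEdges := by
    simpa only [Fintype.card_fin] using ColoredComponents.exists_numEdges_ge c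
  refine ⟨h, ?_, fun c hc => ?_, ColoredComponents.one_div_twelve_add_lt⟩
  · refine (ColoredComponents.isGreatest_M n 4 hn (by norm_num)).2 fun c => ?_
    obtain ⟨C, hC⟩ := h c
    exact ⟨C, Nat.ceil_le.2 hC⟩
  · simpa only [Fintype.card_fin] using ColoredComponents.exists_numEdges_ge_of_hasSmallCover
      (ColoredComponents.hasSmallCover_of_not_sameComponentStructure hc)
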